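/- Let $V$ be a finite-dimensional complex vector space with basis $\{v^i\}_{i=1}^N$. A linear operator $A$ on $V$ has the matrix $A_i^j$ given by $Av^j=\sum_i A_i^j v^i$ (lower index = row, upper index = column), and an operator $B$ on $V\otimes V$ has the matrix $B_{ij}^{kl}$ given by $B(v^k\otimes v^l)=\sum_{i,j}B_{ij}^{kl}\,v^i\otimes v^j$. Subscripts on operators denote the component spaces of a tensor power on which they act, $B_i:=B_{i\,i+1}$, and $P$ is the permutation operator. Let $\hat R\in\mathrm{Aut}(V\otimes V)$ satisfy $\hat R_1\hat R_2\hat R_1=\hat R_2\hat R_1\hat R_2$. Assume that $\hat R$ is skew invertible, i.e. there is $\hat\Psi\in\mathrm{End}(V\otimes V)$ with $\mathrm{Tr}_{(2)}(\hat R_{12}\hat\Psi_{23})=\mathrm{Tr}_{(2)}(\hat\Psi_{12}\hat R_{23})=P_{13}$. Assume further that $\hat R$ is of BMW type: its minimal polynomial is cubic and there are $q\in\mathbb C\setminus\{0,\pm1\}$ and $\nu\in\mathbb C\setminus\{0,q,-q^{-1}\}$ such that for every $n\ge 1$ the assignment $e_i\mapsto\hat R_i$ extends to a representation on $V^{\otimes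 n}$ of the Birman–Murakami–Wenzl algebra $W_n(q,\nu)$. This is the unital algebra with generators $e_i^{\pm1},\kappa_i$ ($1\le i\le n-1$) and relations $e_ie_{i+1}e_i=e_{i+1}e_ie_{i+1}$, $e_ie_j=e_je_i$ for $|i-j|>1$, $e_i^2=1+\lambda(e_i-\nu\kappa_i)$, $e_i\kappa_i=\kappa_ie_i=\nu\kappa_i$, $\kappa_{i+1}e_i^{\pm1}\kappa_{i+1}=\nu^{\mp1}\kappa_{i+1}$, where $\lambda=q-q^{-1}$. Put $\hat K=\lambda^{-1}\nu^{-1}(q-\hat R)(q^{-1}+\hat R)$. Let $\mathcal F(\hat R)$ be the bialgebra generated by the entries of $T=\|T_i^j\|_{i,j=1}^N$ subject to $\hat R_{12}T_1T_2=T_1T_2\hat R_{12}$, with $\Delta(T_i^j)=\sum_kT_i^k\otimes T_k^j$ and $\varepsilon(T_i^j)=\delta_i^j$. Then there are complex matrices $\bar g=(\bar g_{ij})$ and $g=(g^{kl})$ with $\hat K_{ij}^{kl}=\bar g_{ij}\,g^{kl}$. For any such $\bar g,g$, the matrix $X_i^j:=\sum_k g^{jk}\bar g_{ki}$ is invertible,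 there is exactly one $\tau\in\mathcal F(\hat R)$ with $\hat K_{12}T_1T_2=\tau\hat K_{12}$, and this $\tau$ is group-like, $\Delta(\tau)=\tau\otimes\tau$, $\varepsilon(\tau)=1$, and satisfies $$\tau\,T_i^j=(XTX^{-1})_i^j\,\tau\qquad(1\le i,j\le N).$$ -/

import Mathlib

open scoped TensorProduct Kronecker

noncomputable section

namespace FRTBMW

/-! ### Operators on tensor powers, written as matrices

Throughout, a vector space with a basis labelled by `ι` is given.  A linear operator `A` has the
matrix `A i j`, where `i` is the (lower) row index and `j` the (upper) column index, so that
`A (v j) = ∑ i, A i j • v i`.  Operators on `V ⊗ V` are matrices over `ι × ι`, operators on the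
`n`-th tensor power of `V` are matrices over `Fin n → ι`. -/

section Operators

variable {ι : Type*} [Fintype ι] [DecidableEq ι]

/-- The matrix of an operator on `V ⊗ V` in the basis `v i ⊗ v j`. -/
def tensorMatrix {V : Type*} [AddCommGroup V] [Module ℂ V] (b : Module.Basis ι ℂ V)
    (A : (V ⊗[ℂ] V) →ₗ[ℂ] (V ⊗[ℂ] V)) : Matrix (ι × ι) (ι × ι) ℂ :=
  LinearMap.toMatrix (b.tensorProduct b) (b.tensorProduct b) A

/-- `A_{kl}`: the operator on the `n`-th tensor power which acts as `A` on the tensor product of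
the `k`-th and `l`-th component spaces (in this order) and as the identity on the others.
It is used for `k ≠ l` only. -/
def leg {n : ℕ} (k l : Fin n) (A : Matrix (ι × ι) (ι × ι) ℂ) :
    Matrix (Fin n → ι) (Fin n → ι) ℂ :=
  fun f g => if ∀ m, m ≠ k → m ≠ l → f m = g m then A (f k, f l) (g k, g l) else 0

/-- `A_i = A_{i,i+1}` on the `n`-th tensor power, where `i = 0, …, n - 2`. -/
def leg₁ {n : ℕ} (i : Fin (n - 1)) (A : Matrix (ι × ι) (ι × ι) ℂ) :
    Matrix (Fin n → ι) (Fin n → ι) ℂ :=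
  leg ⟨i.1, by omega⟩ ⟨i.1 + 1, by omega⟩ A

/-- The trace over the middle one of three component spaces. -/
def middleTrace (M : Matrix (Fin 3 → ι) (Fin 3 → ι) ℂ) : Matrix (ι × ι) (ι × ι) ℂ :=
  fun p r => ∑ s, M ![p.1, s, p.2] ![r.1, s, r.2]

/-- The permutation operator `u ⊗ v ↦ v ⊗ u`. -/
def flip : Matrix (ι × ι) (ι × ι) ℂ :=
  fun p r => if p.1 = r.2 ∧ p.2 = r.1 then 1 else 0

/-- `R` is an R-matrix: it is invertible and satisfies the braid form of the
Yang-Baxter equation `R₁₂ R₂₃ R₁₂ = R₂₃ R₁₂ R₂₃`. -/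
def IsRMatrix (R : Matrix (ι × ι) (ι × ι) ℂ) : Prop :=
  IsUnit R ∧
    leg (n := 3) 0 1 R * leg 1 2 R * leg 0 1 R = leg (n := 3) 1 2 R * leg 0 1 R * leg 1 2 R

/-- `R` is skew invertible: there is `Ψ` with
`Tr₍₂₎ (R₁₂ Ψ₂₃) = Tr₍₂₎ (Ψ₁₂ R₂₃) = P₁₃`. -/
def IsSkewInvertible (R : Matrix (ι × ι) (ι × ι) ℂ) : Prop :=
  ∃ Ψ : Matrix (ι × ι) (ι × ι) ℂ,
    middleTrace (leg 0 1 R * leg 1 2 Ψ) = flip ∧ middleTrace (leg 0 1 Ψ * leg 1 2 R) = flip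

end Operators

/-! ### The Birman-Murakami-Wenzl algebra -/

/-- Generators of `W_n(q, ν)`: `e i`, their inverses, and `κ i`, for `n - 1` values of `i`. -/
inductive BMWGen (n : ℕ) : Type
  | e (i : Fin (n - 1)) : BMWGen n
  | eInv (i : Fin (n - 1)) : BMWGen n
  | kappa (i : Fin (n - 1)) : BMWGen n

section BMW

/-- The generator `e i` in the free algebra. -/
abbrev fe {n : ℕ} (i : Fin (n - 1)) : FreeAlgebra ℂ (BMWGen n) := FreeAlgebra.ι ℂ (BMWGen.e i)

/-- The generator `(e i)⁻¹` in the free algebra. -/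
abbrev fi {n : ℕ} (i : Fin (n - 1)) : FreeAlgebra ℂ (BMWGen n) := FreeAlgebra.ι ℂ (BMWGen.eInv i)

/-- The generator `κ i` in the free algebra. -/
abbrev fk {n : ℕ} (i : Fin (n - 1)) : FreeAlgebra ℂ (BMWGen n) := FreeAlgebra.ι ℂ (BMWGen.kappa i)

/-- Defining relations of `W_n(q, ν)`, where `lambda = q - q⁻¹`. -/
inductive BMWRel (n : ℕ) (q ν : ℂ) :
    FreeAlgebra ℂ (BMWGen n) → FreeAlgebra ℂ (BMWGen n) → Prop
  | mul_inv (i : Fin (n - 1)) : BMWRel n q ν (fe i * fi i) 1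
  | inv_mul (i : Fin (n - 1)) : BMWRel n q ν (fi i * fe i) 1
  | braid (i j : Fin (n - 1)) (h : j.1 = i.1 + 1) :
      BMWRel n q ν (fe i * fe j * fe i) (fe j * fe i * fe j)
  | comm (i j : Fin (n - 1)) (h : i.1 + 1 < j.1) :
      BMWRel n q ν (fe i * fe j) (fe j * fe i)
  | square (i : Fin (n - 1)) :
      BMWRel n q ν (fe i * fe i) (1 + (q - q⁻¹) • (fe i - ν • fk i))
  | e_kappa (i : Fin (n - 1)) : BMWRel n q ν (fe i * fk i) (ν • fk i)
  | kappa_e (i : Fin (n - 1)) : BMWRel n q ν (fk i * fe i) (ν • fk i)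
  | kappa_e_kappa (i j : Fin (n - 1)) (h : j.1 = i.1 + 1) :
      BMWRel n q ν (fk j * fe i * fk j) (ν⁻¹ • fk j)
  | kappa_inv_kappa (i j : Fin (n - 1)) (h : j.1 = i.1 + 1) :
      BMWRel n q ν (fk j * fi i * fk j) (ν • fk j)

/-- The Birman-Murakami-Wenzl algebra `W_n(q, ν)`. -/
abbrev BMWAlgebra (n : ℕ) (q ν : ℂ) : Type := RingQuot (BMWRel n q ν)

/-- The generator `e i` of `W_n(q, ν)`. -/
def BMWAlgebra.e {n : ℕ} (q ν : ℂ) (i : Fin (n - 1)) : BMWAlgebra n q ν :=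
  RingQuot.mkAlgHom ℂ (BMWRel n q ν) (fe i)

variable {ι : Type*} [Fintype ι] [DecidableEq ι]

/-- `R` is an R-matrix of BMW type with parameters `q`, `ν`: it is an R-matrix, its minimal
polynomial is cubic, the parameters lie in the admissible domain, and `e i ↦ R_i` extends to a
representation of `W_n(q, ν)` on the `n`-th tensor power, for every `n`. -/
structure IsBMWType (q ν : ℂ) (R : Matrix (ι × ι) (ι × ι) ℂ) : Prop where
  q_ne_zero : q ≠ 0
  q_ne_one : q ≠ 1
  q_ne_neg_one : q ≠ -1
  nu_ne_zero : ν ≠ 0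
  nu_ne_q : ν ≠ q
  nu_ne_neg_q_inv : ν ≠ -q⁻¹
  isRMatrix : IsRMatrix R
  cubic : (minpoly ℂ R).natDegree = 3
  representation : ∀ n : ℕ,
    ∃ ρ : BMWAlgebra n q ν →ₐ[ℂ] Matrix (Fin n → ι) (Fin n → ι) ℂ,
      ∀ i : Fin (n - 1), ρ (BMWAlgebra.e q ν i) = leg₁ i R

/-- `K = lambda⁻¹ ν⁻¹ (q I - R) (q⁻¹ I + R)`, where `lambda = q - q⁻¹`. -/
def Kmat (q ν : ℂ) (R : Matrix (ι × ι) (ι × ι) ℂ) : Matrix (ι × ι) (ι × ι) ℂ :=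
  ((q - q⁻¹)⁻¹ * ν⁻¹) • ((q • (1 : Matrix (ι × ι) (ι × ι) ℂ) - R) *
    (q⁻¹ • (1 : Matrix (ι × ι) (ι × ι) ℂ) + R))

/-- `K_{ij}^{kl} = gbar_{ij} g^{kl}`. -/
def IsRankOneFactorization (K : Matrix (ι × ι) (ι × ι) ℂ) (gbar g : Matrix ι ι ℂ) : Prop :=
  ∀ i j k l, K (i, j) (k, l) = gbar i j * g k l

/-- The operator `X`, with lower (row) index `i` and upper (column) index `j`:
`X_i^j = ∑ k, g^{jk} gbar_{ki}`. -/
def Xmat (gbar g : Matrix ι ι ℂ) : Matrix ι ι ℂ :=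
  fun i j => ∑ k, g j k * gbar k i

end BMW

/-! ### The bialgebra of Faddeev, Reshetikhin and Takhtajan -/

section FRT

variable {ι : Type*} [Fintype ι] [DecidableEq ι]

/-- A complex matrix regarded as a matrix over a complex algebra. -/
def scal (S : Type*) [Semiring S] [Algebra ℂ S] {κ : Type*} (A : Matrix κ κ ℂ) : Matrix κ κ S :=
  A.map (algebraMap ℂ S)

/-- The product `M₁ M₂` of `M₁ = M ⊗ I` and `M₂ = I ⊗ M`, for a matrix `M` over an algebra. -/
def prod₁₂ {S : Type*} [Semiring S] (M : Matrix ι ι S) : Matrix (ι × ι) (ι × ι) S :=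
  (M ⊗ₖ (1 : Matrix ι ι S)) * ((1 : Matrix ι ι S) ⊗ₖ M)

/-- The relation `R₁₂ M₁ M₂ = M₁ M₂ R₁₂` for a matrix `M` over an algebra. -/
def IsRTT (R : Matrix (ι × ι) (ι × ι) ℂ) {S : Type*} [Semiring S] [Algebra ℂ S]
    (M : Matrix ι ι S) : Prop :=
  scal S R * prod₁₂ M = prod₁₂ M * scal S R

/-- The matrix of free generators. -/
def freeT (ι : Type*) : Matrix ι ι (FreeAlgebra ℂ (ι × ι)) :=
  fun i j => FreeAlgebra.ι ℂ (i, j)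

/-- The relations `R₁₂ T₁ T₂ = T₁ T₂ R₁₂`, entry by entry. -/
inductive FRTRel (R : Matrix (ι × ι) (ι × ι) ℂ) :
    FreeAlgebra ℂ (ι × ι) → FreeAlgebra ℂ (ι × ι) → Prop
  | rtt (p r : ι × ι) : FRTRel R
      ((scal (FreeAlgebra ℂ (ι × ι)) R * prod₁₂ (freeT ι)) p r)
      ((prod₁₂ (freeT ι) * scal (FreeAlgebra ℂ (ι × ι)) R) p r)

/-- The unital associative algebra with generators `T i j` and relations
`R₁₂ T₁ T₂ = T₁ T₂ R₁₂`. -/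
abbrev FRT (R : Matrix (ι × ι) (ι × ι) ℂ) : Type _ := RingQuot (FRTRel R)

/-- The matrix of generators of `FRT R`. -/
def FRT.T (R : Matrix (ι × ι) (ι × ι) ℂ) : Matrix ι ι (FRT R) :=
  fun i j => RingQuot.mkAlgHom ℂ (FRTRel R) (FreeAlgebra.ι ℂ (i, j))

theorem prod₁₂_apply {S : Type*} [Semiring S] (M : Matrix ι ι S) (p r : ι × ι) :
    prod₁₂ M p r = M p.1 r.1 * M p.2 r.2 := by
  simp only [prod₁₂, Matrix.mul_apply, Matrix.kroneckerMap_apply, Matrix.one_apply]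
  rw [Finset.sum_eq_single (r.1, p.2)]
  · simp
  · rintro ⟨a, c⟩ - h
    by_cases h1 : p.2 = c
    · by_cases h2 : a = r.1
      · exact absurd (by rw [h1, h2]) h
      · simp [h2]
    · simp [h1]
  · simp

theorem scal_map {S S' : Type*} [Semiring S] [Algebra ℂ S] [Semiring S'] [Algebra ℂ S']
    (f : S →ₐ[ℂ] S') {κ : Type*} (A : Matrix κ κ ℂ) : (scal S A).map f = scal S' A := by
  ext i j
  simp [scal]

theorem prod₁₂_map {S S' : Type*} [Semiring S] [Algebra ℂ S] [Semiring S'] [Algebra ℂ S']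
    (f : S →ₐ[ℂ] S') (M : Matrix ι ι S) : (prod₁₂ M).map f = prod₁₂ (M.map f) := by
  ext p r
  simp [prod₁₂_apply]

theorem IsRTT.map {R : Matrix (ι × ι) (ι × ι) ℂ} {S S' : Type*} [Semiring S] [Algebra ℂ S]
    [Semiring S'] [Algebra ℂ S'] (f : S →ₐ[ℂ] S') {M : Matrix ι ι S} (h : IsRTT R M) :
    IsRTT R (M.map f) := by
  have h' := congrArg (fun A => A.map f) h
  simpa only [IsRTT, Matrix.map_mul, scal_map, prod₁₂_map] using h'

theorem prod₁₂_mul {S : Type*} [Semiring S] (A B : Matrix ι ι S)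
    (hc : ∀ i j k l, A i j * B k l = B k l * A i j) :
    prod₁₂ (A * B) = prod₁₂ A * prod₁₂ B := by
  ext p r
  simp only [prod₁₂_apply, Matrix.mul_apply, Fintype.sum_prod_type, Finset.sum_mul_sum]
  refine Finset.sum_congr rfl fun a _ => Finset.sum_congr rfl fun c _ => ?_
  rw [mul_assoc, ← mul_assoc (B a r.1), ← hc p.2 c a r.1]
  simp only [mul_assoc]

theorem IsRTT.mul {R : Matrix (ι × ι) (ι × ι) ℂ} {S : Type*} [Semiring S] [Algebra ℂ S]
    {A B : Matrix ι ι S} (hA : IsRTT R A) (hB : IsRTT R B)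
    (hc : ∀ i j k l, A i j * B k l = B k l * A i j) : IsRTT R (A * B) := by
  unfold IsRTT at *
  rw [prod₁₂_mul A B hc, ← mul_assoc, hA, mul_assoc, hB, mul_assoc]

theorem isRTT_one (R : Matrix (ι × ι) (ι × ι) ℂ) : IsRTT R (1 : Matrix ι ι ℂ) := by
  simp [IsRTT, prod₁₂]

theorem FRT.map_freeT {R : Matrix (ι × ι) (ι × ι) ℂ} :
    (freeT ι).map (RingQuot.mkAlgHom ℂ (FRTRel R)) = FRT.T R := rfl

theorem FRT.isRTT_T (R : Matrix (ι × ι) (ι × ι) ℂ) : IsRTT R (FRT.T R) := by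
  ext p r
  have h := RingQuot.mkAlgHom_rel ℂ (FRTRel.rtt (R := R) p r)
  have h1 : ((scal (FreeAlgebra ℂ (ι × ι)) R * prod₁₂ (freeT ι)).map
      (RingQuot.mkAlgHom ℂ (FRTRel R))) p r = ((prod₁₂ (freeT ι) *
        scal (FreeAlgebra ℂ (ι × ι)) R).map (RingQuot.mkAlgHom ℂ (FRTRel R))) p r := h
  simpa only [Matrix.map_mul, scal_map, prod₁₂_map, FRT.map_freeT] using h1

/-- The algebra map out of `FRT R` which sends `T i j` to `M i j`. -/
def FRT.lift {R : Matrix (ι × ι) (ι × ι) ℂ} {S : Type*} [Semiring S] [Algebra ℂ S]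
    (M : Matrix ι ι S) (hM : IsRTT R M) : FRT R →ₐ[ℂ] S :=
  RingQuot.liftAlgHom ℂ ⟨FreeAlgebra.lift ℂ fun p => M p.1 p.2, by
    have hT : (freeT ι).map (FreeAlgebra.lift ℂ fun p : ι × ι => M p.1 p.2) = M := by
      ext i j
      simp [freeT]
    rintro _ _ ⟨p, r⟩
    have h := congrFun (congrFun hM p) r
    rw [← hT, ← scal_map (FreeAlgebra.lift ℂ fun p : ι × ι => M p.1 p.2) R, ← prod₁₂_map,
      ← Matrix.map_mul, ← Matrix.map_mul] at h
    exact h⟩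

@[simp]
theorem FRT.lift_T {R : Matrix (ι × ι) (ι × ι) ℂ} {S : Type*} [Semiring S] [Algebra ℂ S]
    (M : Matrix ι ι S) (hM : IsRTT R M) (i j : ι) : FRT.lift M hM (FRT.T R i j) = M i j := by
  simp [FRT.lift, FRT.T]

theorem FRT.algHom_ext {R : Matrix (ι × ι) (ι × ι) ℂ} {S : Type*} [Semiring S] [Algebra ℂ S]
    {f f' : FRT R →ₐ[ℂ] S} (h : ∀ i j, f (FRT.T R i j) = f' (FRT.T R i j)) : f = f' := by
  apply RingQuot.ringQuot_ext'
  apply FreeAlgebra.hom_ext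
  funext p
  exact h p.1 p.2

/-- The matrix with entries `∑ k, T i k ⊗ T k j`. -/
def FRT.comulT (R : Matrix (ι × ι) (ι × ι) ℂ) : Matrix ι ι (FRT R ⊗[ℂ] FRT R) :=
  fun i j => ∑ k, FRT.T R i k ⊗ₜ[ℂ] FRT.T R k j

theorem FRT.isRTT_comulT (R : Matrix (ι × ι) (ι × ι) ℂ) : IsRTT R (FRT.comulT R) := by
  have h : FRT.comulT R =
      (FRT.T R).map (Algebra.TensorProduct.includeLeft : FRT R →ₐ[ℂ] FRT R ⊗[ℂ] FRT R) *
      (FRT.T R).map (Algebra.TensorProduct.includeRight : FRT R →ₐ[ℂ] FRT R ⊗[ℂ] FRT R) := by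
    ext i j
    simp [FRT.comulT, Matrix.mul_apply]
  rw [h]
  exact ((FRT.isRTT_T R).map _).mul ((FRT.isRTT_T R).map _) (by intros; simp)

/-- The bialgebra structure: `Δ (T i j) = ∑ k, T i k ⊗ T k j`, `ε (T i j) = δ i j`. -/
instance FRT.instBialgebra (R : Matrix (ι × ι) (ι × ι) ℂ) : Bialgebra ℂ (FRT R) :=
  Bialgebra.ofAlgHom (FRT.lift (FRT.comulT R) (FRT.isRTT_comulT R)) (FRT.lift 1 (isRTT_one R))
    (by
      apply FRT.algHom_ext
      intro i j
      simp only [AlgHom.comp_apply, FRT.lift_T, FRT.comulT, map_sum,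
        Algebra.TensorProduct.map_tmul, AlgHom.coe_id, id_eq, TensorProduct.sum_tmul,
        TensorProduct.tmul_sum]
      exact Finset.sum_comm)
    (by
      apply FRT.algHom_ext
      intro i j
      simp [FRT.comulT, Matrix.one_apply, TensorProduct.ite_tmul])
    (by
      apply FRT.algHom_ext
      intro i j
      simp [FRT.comulT, Matrix.one_apply, TensorProduct.tmul_ite])

theorem FRT.comul_T (R : Matrix (ι × ι) (ι × ι) ℂ) (i j : ι) :
    Coalgebra.comul (R := ℂ) (FRT.T R i j) = ∑ k, FRT.T R i k ⊗ₜ[ℂ] FRT.T R k j :=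
  FRT.lift_T (FRT.comulT R) (FRT.isRTT_comulT R) i j

theorem FRT.counit_T (R : Matrix (ι × ι) (ι × ι) ℂ) (i j : ι) :
    Coalgebra.counit (R := ℂ) (FRT.T R i j) = if i = j then 1 else 0 :=
  (FRT.lift_T 1 (isRTT_one R) i j).trans (Matrix.one_apply)

/-- `K₁₂ T₁ T₂ = τ K₁₂`, an equality of matrices over `FRT R`. -/
def IsTau (R K : Matrix (ι × ι) (ι × ι) ℂ) (τ : FRT R) : Prop :=
  scal (FRT R) K * prod₁₂ (FRT.T R) = τ • scal (FRT R) K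

/-- The matrix `X T X⁻¹` over `FRT R`. -/
def FRT.conjT (R : Matrix (ι × ι) (ι × ι) ℂ) (X : Matrix ι ι ℂ) : Matrix ι ι (FRT R) :=
  scal (FRT R) X * FRT.T R * scal (FRT R) X⁻¹

end FRT

end FRTBMW

end

set_option linter.unusedSectionVars false

/-! Everything comes from two relations of `W₃` for `K`: `K₁ K₂ K₁ = K₁` and `K₂ K₁ = R₁ R₂ K₁`.
They apply because the quadratic relation expresses `κ` through `e`, so the representation must send
`κ_i` to `K_i`; `K` itself is nonzero because the minimal polynomial of `R` is cubic.

Rank one: skew invertibility cancels both copies of `R` in `K₂ K₁ = R₁ R₂ K₁`. What remains writes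
the identity of `V` tensored with any 2×2 minor block of `K` as a map factoring through `V`. An
invertible block would give rank `2N ≤ N`, so all 2×2 minors of `K` vanish
(`exists_factorization_of_skew`, `minor_eq_zero_of_factorization`). With `K = gbar g`, the relation
`K₁ K₂ K₁ = K₁` exhibits `gbar * g` as the inverse of `X`.

The element `τ`: being a polynomial in `R`, `K` commutes with `T₁ T₂`; for rank one this says that
`g T₁ T₂ = τ g` and `T₁ T₂ gbar = τ gbar` with the same `τ`. A nonzero entry of `K` makes `τ`
unique, and applying `Δ` and `ε` to the defining equation shows that it is group-like. Evaluating
`g₁₂ T₁ T₂ T₃ gbar₂₃` by either identity gives `X T τ = τ T X`. -/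

namespace FRTBMW

/-! ### Reordering iterated finite sums. -/

section Sums

variable {α β γ δ ε M : Type*} [Fintype α] [Fintype β] [Fintype γ] [Fintype δ] [Fintype ε]
  [AddCommMonoid M]

theorem sum_comm_two (F : α → β → γ → M) :
    ∑ a, ∑ b, ∑ c, F a b c = ∑ b, ∑ c, ∑ a, F a b c := by
  rw [Finset.sum_comm]
  exact Finset.sum_congr rfl fun b _ => Finset.sum_comm

theorem sum_comm_three (F : α → β → γ → δ → M) :
    ∑ a, ∑ b, ∑ c, ∑ d, F a b c d = ∑ b, ∑ c, ∑ d, ∑ a, F a b c d := by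
  rw [Finset.sum_comm]
  exact Finset.sum_congr rfl fun b _ => sum_comm_two _

theorem sum_comm_four (F : α → β → γ → δ → ε → M) :
    ∑ a, ∑ b, ∑ c, ∑ d, ∑ e, F a b c d e = ∑ b, ∑ c, ∑ d, ∑ e, ∑ a, F a b c d e := by
  rw [Finset.sum_comm]
  exact Finset.sum_congr rfl fun b _ => sum_comm_three _

theorem sum_comm_two_two (F : α → β → γ → δ → M) :
    ∑ a, ∑ b, ∑ c, ∑ d, F a b c d = ∑ c, ∑ d, ∑ a, ∑ b, F a b c d := by
  simp only [sum_comm_two (fun b c d => F _ b c d)]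
  exact sum_comm_two _

end Sums

/-! ### Operators on two of three tensor factors, in indices. -/

section Legs

variable {ι : Type*} [Fintype ι] [DecidableEq ι]

theorem sum_fin_three {M : Type*} [AddCommMonoid M] (F : (Fin 3 → ι) → M) :
    ∑ h, F h = ∑ a, ∑ b, ∑ c, F ![a, b, c] := by
  let e : (Fin 3 → ι) ≃ ι × ι × ι :=
    { toFun := fun h => (h 0, h 1, h 2)
      invFun := fun t => ![t.1, t.2.1, t.2.2]
      left_inv := fun h => by ext i; fin_cases i <;> rfl
      right_inv := fun t => rfl }
  rw [← e.symm.sum_comp, Fintype.sum_prod_type]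
  refine Finset.sum_congr rfl fun a _ => ?_
  rw [Fintype.sum_prod_type]
  rfl

theorem matrix_fin_three_ext {S : Type*} {A B : Matrix (Fin 3 → ι) (Fin 3 → ι) S}
    (h : ∀ a b c a' b' c', A ![a, b, c] ![a', b', c'] = B ![a, b, c] ![a', b', c']) : A = B := by
  ext f g
  have hv : ∀ f : Fin 3 → ι, f = ![f 0, f 1, f 2] := fun f => by
    ext i; fin_cases i <;> rfl
  rw [hv f, hv g]
  exact h ..

theorem leg_zero_one_apply (A : Matrix (ι × ι) (ι × ι) ℂ) (a b c a' b' c' : ι) :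
    leg (n := 3) 0 1 A ![a, b, c] ![a', b', c'] = if c = c' then A (a, b) (a', b') else 0 := by
  simp [leg, Fin.forall_fin_succ]

theorem leg_one_two_apply (A : Matrix (ι × ι) (ι × ι) ℂ) (a b c a' b' c' : ι) :
    leg (n := 3) 1 2 A ![a, b, c] ![a', b', c'] = if a = a' then A (b, c) (b', c') else 0 := by
  simp [leg, Fin.forall_fin_succ]

theorem leg_zero_one_mul (A B : Matrix (ι × ι) (ι × ι) ℂ) :
    leg (n := 3) 0 1 (A * B) = leg (n := 3) 0 1 A * leg (n := 3) 0 1 B := by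
  apply matrix_fin_three_ext
  intro a b c a' b' c'
  rw [Matrix.mul_apply, sum_fin_three]
  simp only [leg_zero_one_apply, Matrix.mul_apply, Fintype.sum_prod_type, ite_mul, zero_mul,
    mul_ite, mul_zero]
  by_cases h : c = c' <;> simp [h]

theorem leg_one_two_mul (A B : Matrix (ι × ι) (ι × ι) ℂ) :
    leg (n := 3) 1 2 (A * B) = leg (n := 3) 1 2 A * leg (n := 3) 1 2 B := by
  apply matrix_fin_three_ext
  intro a b c a' b' c'
  rw [Matrix.mul_apply, sum_fin_three]
  simp only [leg_one_two_apply, Matrix.mul_apply, Fintype.sum_prod_type, ite_mul, zero_mul,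
    mul_ite, mul_zero]
  by_cases h : a = a' <;> simp [h]

theorem leg_add {n : ℕ} (k l : Fin n) (A B : Matrix (ι × ι) (ι × ι) ℂ) :
    leg k l (A + B) = leg k l A + leg k l B := by
  ext f g
  simp only [leg, Matrix.add_apply]
  split_ifs <;> simp

theorem leg_sub {n : ℕ} (k l : Fin n) (A B : Matrix (ι × ι) (ι × ι) ℂ) :
    leg k l (A - B) = leg k l A - leg k l B := by
  ext f g
  simp only [leg, Matrix.sub_apply]
  split_ifs <;> simp

theorem leg_smul {n : ℕ} (k l : Fin n) (c : ℂ) (A : Matrix (ι × ι) (ι × ι) ℂ) :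
    leg k l (c • A) = c • leg k l A := by
  ext f g
  simp only [leg, Matrix.smul_apply]
  split_ifs <;> simp

theorem leg_one {n : ℕ} (k l : Fin n) : leg k l (1 : Matrix (ι × ι) (ι × ι) ℂ) = 1 := by
  ext f g
  simp only [leg, Matrix.one_apply, Prod.mk.injEq, ← ite_and]
  congr 1
  simp only [eq_iff_iff]
  constructor
  · rintro ⟨h, hk, hl⟩
    ext m
    by_cases h1 : m = k
    · rw [h1, hk]
    · by_cases h2 : m = l
      · rw [h2, hl]
      · exact h m h1 h2
  · rintro rfl
    simp

theorem leg_zero_one_Kmat (q ν : ℂ) (R : Matrix (ι × ι) (ι × ι) ℂ) :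
    leg (n := 3) 0 1 (Kmat q ν R) = ((q - q⁻¹)⁻¹ * ν⁻¹) •
      ((q • 1 - leg (n := 3) 0 1 R) * (q⁻¹ • 1 + leg (n := 3) 0 1 R)) := by
  simp only [Kmat, leg_smul, leg_zero_one_mul, leg_add, leg_sub, leg_one]

theorem leg_one_two_Kmat (q ν : ℂ) (R : Matrix (ι × ι) (ι × ι) ℂ) :
    leg (n := 3) 1 2 (Kmat q ν R) = ((q - q⁻¹)⁻¹ * ν⁻¹) •
      ((q • 1 - leg (n := 3) 1 2 R) * (q⁻¹ • 1 + leg (n := 3) 1 2 R)) := by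
  simp only [Kmat, leg_smul, leg_one_two_mul, leg_add, leg_sub, leg_one]

end Legs

/-! ### Consequences of the BMW relations in an arbitrary algebra. -/

section Algebra

variable {S : Type*} [Ring S] [Algebra ℂ S]

/-- The quadratic relation can be solved for `κ` because `λ` and `ν` are nonzero. Hence a
representation prescribed only on the `e i` has its values on the `κ i` forced. -/
theorem kappa_eq_of_square {q ν : ℂ} (hq : q ≠ 0) (hl : q - q⁻¹ ≠ 0) (hν : ν ≠ 0) {e k : S}
    (h : e * e = 1 + (q - q⁻¹) • (e - ν • k)) :
    k = ((q - q⁻¹)⁻¹ * ν⁻¹) • ((q • 1 - e) * (q⁻¹ • 1 + e)) := by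
  have h1 : (q • 1 - e) * (q⁻¹ • 1 + e) = ((q - q⁻¹) * ν) • k := by
    simp only [sub_mul, mul_add, smul_mul_assoc, mul_smul_comm, one_mul, mul_one, h]
    linear_combination (norm := module) (mul_inv_cancel₀ hq) • (1 : S)
  rw [h1, smul_smul, mul_mul_mul_comm, inv_mul_cancel₀ hl, inv_mul_cancel₀ hν, mul_one, one_smul]

/-- `κ₁ κ₀ κ₁ = κ₁` follows from `κ₁ e₀ κ₁ = ν⁻¹ κ₁` and `κ₁ e₀⁻¹ κ₁ = ν κ₁`. -/
theorem kappa_mul_kappa_mul_kappa {q ν : ℂ} (hl : q - q⁻¹ ≠ 0) (hν : ν ≠ 0) {e f k e' k' : S}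
    (hfe : f * e = 1)
    (hs : e * e = 1 + (q - q⁻¹) • (e - ν • k))
    (hs' : e' * e' = 1 + (q - q⁻¹) • (e' - ν • k'))
    (hek : e * k = ν • k) (hek' : e' * k' = ν • k')
    (h1 : k' * e * k' = ν⁻¹ • k') (h2 : k' * f * k' = ν • k') : k' * k * k' = k' := by
  have hfk : f * k = ν⁻¹ • k := by
    have : ν • (f * k) = k := by rw [← mul_smul_comm, ← hek, ← mul_assoc, hfe, one_mul]
    rw [← this, smul_smul, inv_mul_cancel₀ hν, one_smul, this]
  -- Multiplying the quadratic relation by the inverse `f` of `e` turns it into the skein relation,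
  -- which is linear in `e`, `f`, `k`.
  have hk : (q - q⁻¹) • k = (q - q⁻¹) • 1 - e + f := by
    have : f * (e * e) = f * (1 + (q - q⁻¹) • (e - ν • k)) := by rw [hs]
    rw [← mul_assoc, hfe, one_mul, mul_add, mul_smul_comm, mul_sub, mul_smul_comm, hfk, hfe,
      mul_one, smul_smul, mul_inv_cancel₀ hν, one_smul, smul_sub] at this
    rw [this]; abel
  -- The loop value of `κ`. Its terms `ν⁻¹` and `-ν` cancel against `h1` and `h2` when the skein
  -- relation is placed between two copies of `k'`.
  have hkk : (q - q⁻¹) • (k' * k') = ((q - q⁻¹) + ν⁻¹ - ν) • k' := by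
    have : (e' * e') * k' = (1 + (q - q⁻¹) • (e' - ν • k')) * k' := by rw [hs']
    rw [mul_assoc, hek', mul_smul_comm, hek', add_mul, smul_mul_assoc, sub_mul, hek',
      smul_mul_assoc, one_mul] at this
    have h3 : ν • ((q - q⁻¹) • (k' * k')) = (1 + (q - q⁻¹) * ν - ν * ν) • k' := by
      linear_combination (norm := module) this
    have h4 := congrArg (fun x => ν⁻¹ • x) h3
    simp only [smul_smul] at h4
    rw [← mul_assoc, inv_mul_cancel₀ hν, one_mul] at h4
    rw [h4]
    congr 1
    field_simp
    ring
  have : (q - q⁻¹) • (k' * k * k') = (q - q⁻¹) • k' := by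
    rw [← smul_mul_assoc, ← mul_smul_comm, hk, mul_add, mul_sub, add_mul, sub_mul, h1, h2,
      mul_smul_comm, mul_one, smul_mul_assoc, hkk]
    module
  exact smul_right_injective S hl this

/-- Each `κ` is the same polynomial in its own `e`, so whatever intertwines the `e`'s intertwines
the `κ`'s. -/
theorem kappa_conj {q ν : ℂ} (hq : q ≠ 0) (hl : q - q⁻¹ ≠ 0) (hν : ν ≠ 0) {x e k e' k' : S}
    (hs : e * e = 1 + (q - q⁻¹) • (e - ν • k))
    (hs' : e' * e' = 1 + (q - q⁻¹) • (e' - ν • k')) (h : x * e = e' * x) : x * k = k' * x := by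
  have h1 : x * (q • 1 - e) = (q • 1 - e') * x := by simp [mul_sub, sub_mul, h]
  have h2 : x * (q⁻¹ • 1 + e) = (q⁻¹ • 1 + e') * x := by simp [mul_add, add_mul, h]
  rw [kappa_eq_of_square hq hl hν hs, kappa_eq_of_square hq hl hν hs', mul_smul_comm,
    smul_mul_assoc, ← mul_assoc, h1, mul_assoc, h2, mul_assoc]

end Algebra

/-! ### The operator `K` of a BMW-type R-matrix. -/

section BMWType

variable {ι : Type*} [Fintype ι] [DecidableEq ι] {q ν : ℂ} {R : Matrix (ι × ι) (ι × ι) ℂ}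

theorem IsBMWType.sub_inv_ne_zero (h : IsBMWType q ν R) : q - q⁻¹ ≠ 0 := by
  intro h0
  have : (q - 1) * (q + 1) = 0 := by
    have h1 : q * q⁻¹ = 1 := mul_inv_cancel₀ h.q_ne_zero
    linear_combination q * h0 + h1
  rcases mul_eq_zero.1 this with h1 | h1
  · exact h.q_ne_one (sub_eq_zero.1 h1)
  · exact h.q_ne_neg_one (eq_neg_of_add_eq_zero_left h1)

/-- If `K` vanished, `R` would be annihilated by a quadratic polynomial, against the cubic minimal
polynomial. -/
theorem IsBMWType.Kmat_ne_zero (h : IsBMWType q ν R) : Kmat q ν R ≠ 0 := by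
  intro h0
  have h1 : (q • (1 : Matrix (ι × ι) (ι × ι) ℂ) - R) * (q⁻¹ • 1 + R) = 0 := by
    refine (smul_eq_zero.1 h0).resolve_left ?_
    exact mul_ne_zero (inv_ne_zero h.sub_inv_ne_zero) (inv_ne_zero h.nu_ne_zero)
  open Polynomial in
  have h2 : aeval R ((C q - X) * (C q⁻¹ + X) : ℂ[X]) = 0 := by
    simpa [Algebra.algebraMap_eq_smul_one] using h1
  have hd : ((Polynomial.C q - Polynomial.X) * (Polynomial.C q⁻¹ + Polynomial.X)).natDegree
      = 2 := by
    compute_degree!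
  have hn : (Polynomial.C q - Polynomial.X) * (Polynomial.C q⁻¹ + Polynomial.X) ≠ 0 := by
    intro h3
    rw [h3] at hd
    simp at hd
  have h4 := Polynomial.natDegree_le_of_dvd (minpoly.dvd ℂ R h2) hn
  rw [h.cubic, hd] at h4
  omega

/-- The relations `κ₀ κ₁ κ₀ = κ₀` and `κ₁ κ₀ = e₀ e₁ κ₀` of `W₃`, for the operator `K`. -/
theorem IsBMWType.Kmat_relations (h : IsBMWType q ν R) :
    leg (n := 3) 0 1 (Kmat q ν R) * leg (n := 3) 1 2 (Kmat q ν R) *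
        leg (n := 3) 0 1 (Kmat q ν R) = leg (n := 3) 0 1 (Kmat q ν R) ∧
      leg (n := 3) 1 2 (Kmat q ν R) * leg (n := 3) 0 1 (Kmat q ν R) =
        leg (n := 3) 0 1 R * leg (n := 3) 1 2 R * leg (n := 3) 0 1 (Kmat q ν R) := by
  obtain ⟨ρ, hρ⟩ := h.representation 3
  have hq := h.q_ne_zero
  have hl := h.sub_inv_ne_zero
  have hν := h.nu_ne_zero
  let φ : FreeAlgebra ℂ (BMWGen 3) →ₐ[ℂ] Matrix (Fin 3 → ι) (Fin 3 → ι) ℂ :=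
    ρ.comp (RingQuot.mkAlgHom ℂ (BMWRel 3 q ν))
  have hφ : ∀ {x y}, BMWRel 3 q ν x y → φ x = φ y := fun hr =>
    congrArg ρ (RingQuot.mkAlgHom_rel ℂ hr)
  have he0 : φ (fe 0) = leg (n := 3) 0 1 R := hρ 0
  have he1 : φ (fe 1) = leg (n := 3) 1 2 R := hρ 1
  have hinv (i : Fin 2) := hφ (BMWRel.mul_inv i)
  have hinv' (i : Fin 2) := hφ (BMWRel.inv_mul i)
  have hsq (i : Fin 2) := hφ (BMWRel.square i)
  have hek (i : Fin 2) := hφ (BMWRel.e_kappa i)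
  have hbr := hφ (BMWRel.braid 0 1 rfl)
  have hkek := hφ (BMWRel.kappa_e_kappa 0 1 rfl)
  have hkfk := hφ (BMWRel.kappa_inv_kappa 0 1 rfl)
  simp only [map_mul, map_add, map_sub, map_smul, map_one] at hinv hinv' hsq hek hbr hkek hkfk
  have hk0 : φ (fk 0) = leg (n := 3) 0 1 (Kmat q ν R) := by
    rw [leg_zero_one_Kmat, ← he0]
    exact kappa_eq_of_square hq hl hν (hsq 0)
  have hk1 : φ (fk 1) = leg (n := 3) 1 2 (Kmat q ν R) := by
    rw [leg_one_two_Kmat, ← he1]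
    exact kappa_eq_of_square hq hl hν (hsq 1)
  rw [← hk0, ← hk1, ← he0, ← he1]
  have hinv0 := hinv 0
  have hinv0' := hinv' 0
  have hinv1 := hinv 1
  have hsq0 := hsq 0
  have hsq1 := hsq 1
  have hek0 := hek 0
  have hek1 := hek 1
  generalize φ (fe 0) = e0 at *
  generalize φ (fe 1) = e1 at *
  generalize φ (fi 0) = f0 at *
  generalize φ (fi 1) = f1 at *
  generalize φ (fk 0) = k0 at *
  generalize φ (fk 1) = k1 at *
  have hkkk : k1 * k0 * k1 = k1 :=
    kappa_mul_kappa_mul_kappa hl hν hinv0' hsq0 hsq1 hek0 hek1 hkek hkfk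
  have hc : e0 * e1 * k0 = k1 * (e0 * e1) :=
    kappa_conj hq hl hν hsq0 hsq1 (by rw [hbr, mul_assoc])
  -- Conjugation by the half twist `e0 * e1 * e0` exchanges the two strands' generators; it carries
  -- `k1 * k0 * k1 = k1` to `k0 * k1 * k0 = k0`.
  have hd0 : e0 * e1 * e0 * k0 = k1 * (e0 * e1 * e0) :=
    kappa_conj hq hl hν hsq0 hsq1 (by rw [hbr]; simp only [mul_assoc] at hbr ⊢; rw [hbr])
  have hd1 : e0 * e1 * e0 * k1 = k0 * (e0 * e1 * e0) :=
    kappa_conj hq hl hν hsq1 hsq0 (by rw [mul_assoc, mul_assoc, ← mul_assoc e1, ← hbr])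
  have hkkk' : k0 * k1 * k0 = k0 := by
    have h1 : (k0 * k1 * k0) * (e0 * e1 * e0) = k0 * (e0 * e1 * e0) := by
      rw [mul_assoc, ← hd1, mul_assoc, ← mul_assoc k1, ← hd0, ← mul_assoc k0, ← mul_assoc k0,
        ← hd1, mul_assoc, mul_assoc, ← mul_assoc k1, hkkk]
    have h2 : (e0 * e1 * e0) * (f0 * f1 * f0) = 1 := by
      rw [mul_assoc, ← mul_assoc e0 (f0 * f1), ← mul_assoc e0 f0, hinv0, one_mul, mul_assoc,
        ← mul_assoc e1 f1, hinv1, one_mul, hinv0]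
    calc k0 * k1 * k0 = k0 * k1 * k0 * (e0 * e1 * e0) * (f0 * f1 * f0) := by
          rw [mul_assoc _ (e0 * e1 * e0), h2, mul_one]
      _ = k0 := by rw [h1, mul_assoc, h2, mul_one]
  refine ⟨hkkk', ?_⟩
  calc k1 * k0 = ν • (ν⁻¹ • k1) * k0 := by rw [smul_smul, mul_inv_cancel₀ hν, one_smul]
    _ = k1 * e0 * (e1 * k1) * k0 := by
      rw [hek1, ← hkek, mul_smul_comm]
    _ = k1 * (e0 * e1) * (k1 * k0) := by simp only [mul_assoc]
    _ = e0 * e1 * k0 := by rw [← hc, mul_assoc, ← mul_assoc k0, hkkk']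

end BMWType

/-! ### `K` has rank one. -/

section RankOne

variable {ι : Type*} [Fintype ι] [DecidableEq ι] {q ν : ℂ} {R : Matrix (ι × ι) (ι × ι) ℂ}

/-- The index form in which `Ψ` cancels an `R` whose second lower and second upper indices are both
summed. -/
theorem IsSkewInvertible.exists_contraction (h : IsSkewInvertible R) :
    ∃ Ψ : Matrix (ι × ι) (ι × ι) ℂ, ∀ p x p' x',
      ∑ s, ∑ m, R (p, s) (x, m) * Ψ (m, x') (s, p') =
        if p = p' then if x = x' then 1 else 0 else 0 := by
  obtain ⟨Ψ, hΨ, -⟩ := h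
  refine ⟨Ψ, fun p x p' x' => ?_⟩
  have h1 := congrFun (congrFun hΨ (p, x')) (x, p')
  simp only [middleTrace, Matrix.mul_apply, sum_fin_three, leg_zero_one_apply,
    leg_one_two_apply, flip, ite_mul, mul_ite, zero_mul, mul_zero] at h1
  simp only [Finset.sum_ite_irrel, Finset.sum_const_zero, Finset.sum_ite_eq,
    Finset.sum_ite_eq', Finset.mem_univ, if_true] at h1
  rw [h1, ite_and]
  simp only [eq_comm]

/-- For `R` skew invertible, `K₂ K₁ = R₁ R₂ K₁` implies that `1 ⊗ Kᵀ` factors through `V`. -/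
theorem exists_factorization_of_skew {K : Matrix (ι × ι) (ι × ι) ℂ} (hs : IsSkewInvertible R)
    (hK : leg (n := 3) 1 2 K * leg (n := 3) 0 1 K =
      leg (n := 3) 0 1 R * leg (n := 3) 1 2 R * leg (n := 3) 0 1 K) :
    ∃ C : ι → ι → ι × ι → ℂ, ∀ p p' x a,
      ∑ j, K (p, j) a * C j p' x = if p = p' then K x a else 0 := by
  obtain ⟨Ψ, hΨ⟩ := hs.exists_contraction
  have hL : ∀ p b b' a k, ∑ j, K (p, j) a * K (b, b') (j, k) =
      ∑ x, ∑ y, ∑ z, R (p, b) (x, z) * R (z, b') (y, k) * K (x, y) a := by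
    rintro p b b' ⟨a, a'⟩ k
    have h1 := congrFun (congrFun hK ![p, b, b']) ![a, a', k]
    simp only [Matrix.mul_apply, sum_fin_three, leg_zero_one_apply, leg_one_two_apply, ite_mul,
      mul_ite, zero_mul, mul_zero, Finset.sum_ite_irrel, Finset.sum_const_zero,
      Finset.sum_ite_eq, Finset.sum_ite_eq', Finset.mem_univ, if_true] at h1
    simp only [mul_comm (K (p, _) _), h1, Finset.sum_mul]
  -- `C` is what multiplies `K (p, j) a` once `hL` is contracted with `Ψ` over `b', k`, cancelling
  -- the second `R`, and then over `b, z`, cancelling the first.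
  refine ⟨fun j p' x => ∑ b, ∑ z, (∑ b', ∑ k, K (b, b') (j, k) * Ψ (k, x.2) (b', z)) *
    Ψ (z, x.1) (b, p'), ?_⟩
  rintro p p' ⟨x', y'⟩ a
  have h1 : ∀ b z', ∑ b', ∑ k, (∑ j, K (p, j) a * K (b, b') (j, k)) * Ψ (k, y') (b', z') =
      ∑ x, R (p, b) (x, z') * K (x, y') a := by
    intro b z'
    calc _ = ∑ x, ∑ y, ∑ z, R (p, b) (x, z) * K (x, y) a *
          ∑ b', ∑ k, R (z, b') (y, k) * Ψ (k, y') (b', z') := by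
          simp only [hL, Finset.sum_mul, Finset.mul_sum]
          simp only [sum_comm_three (fun k x y z => R (p, b) (x, z) * R (z, _) (y, k) *
            K (x, y) a * Ψ (k, y') (_, z'))]
          rw [sum_comm_three]
          simp only [mul_assoc, mul_left_comm (K _ _)]
      _ = _ := by simp [hΨ]
  calc _ = ∑ b, ∑ z, (∑ b', ∑ k, (∑ j, K (p, j) a * K (b, b') (j, k)) * Ψ (k, y') (b', z)) *
          Ψ (z, x') (b, p') := by
        simp only [Finset.sum_mul, Finset.mul_sum]
        rw [sum_comm_four]
        simp only [mul_assoc]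
    _ = ∑ x, K (x, y') a * ∑ b, ∑ z, R (p, b) (x, z) * Ψ (z, x') (b, p') := by
        simp only [h1]
        simp only [Finset.sum_mul, Finset.mul_sum]
        refine Eq.trans ?_ (sum_comm_two _).symm
        refine Finset.sum_congr rfl fun b _ => Finset.sum_congr rfl fun z _ =>
          Finset.sum_congr rfl fun x _ => ?_
        ring
    _ = _ := by simp [hΨ]

theorem minor_eq_zero_of_factorization [Nonempty ι] {κ : Type*} {K : Matrix κ κ ℂ}
    {B : ι → ι → κ → ℂ} {C : ι → ι → κ → ℂ}
    (h : ∀ p p' x a, ∑ j, B p j a * C j p' x = if p = p' then K x a else 0) (x y a b : κ) :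
    K x a * K y b = K x b * K y a := by
  by_contra hne
  let S : Matrix (Fin 2) (Fin 2) ℂ := fun s t => K (![x, y] t) (![a, b] s)
  have hS : S.det ≠ 0 := by
    rw [Matrix.det_fin_two]
    simp only [S, Matrix.cons_val_zero, Matrix.cons_val_one]
    rw [sub_ne_zero, mul_comm (K y a)]
    exact hne
  let M : Matrix (ι × Fin 2) ι ℂ := fun r j => B r.1 j (![a, b] r.2)
  let N : Matrix ι (ι × Fin 2) ℂ := fun j r => C j r.1 (![x, y] r.2)
  have hMN : M * N = (1 : Matrix ι ι ℂ) ⊗ₖ S := by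
    ext r r'
    rw [Matrix.mul_apply, Matrix.kroneckerMap_apply, Matrix.one_apply, ite_mul, one_mul, zero_mul]
    exact h ..
  -- An invertible matrix of size `2N` cannot factor through dimension `N` when `N > 0`.
  have hu : IsUnit (M * N) := by
    rw [Matrix.isUnit_iff_isUnit_det, hMN, Matrix.det_kronecker]
    simp [hS]
  have h1 := Matrix.rank_of_isUnit _ hu
  have h2 := (Matrix.rank_mul_le_left M N).trans M.rank_le_card_width
  rw [h1, Fintype.card_prod, Fintype.card_fin] at h2
  have := Fintype.card_pos (α := ι)
  omega

theorem exists_isRankOneFactorization {K : Matrix (ι × ι) (ι × ι) ℂ}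
    (h : ∀ x y a b, K x a * K y b = K x b * K y a) :
    ∃ gbar g : Matrix ι ι ℂ, IsRankOneFactorization K gbar g := by
  by_cases hK : K = 0
  · exact ⟨0, 0, fun i j k l => by simp [hK]⟩
  · obtain ⟨x, a, hxa⟩ : ∃ x a, K x a ≠ 0 := by
      by_contra! h0
      exact hK (Matrix.ext h0)
    -- The column and row of `K` through a nonzero pivot, the row divided by the pivot.
    refine ⟨fun i j => K (i, j) a, fun k l => (K x a)⁻¹ * K x (k, l), fun i j k l => ?_⟩
    have := h x (i, j) a (k, l)
    field_simp
    linear_combination this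

end RankOne

/-! ### Invertibility of `X`, and the element `τ`. -/

section Tau

variable {ι : Type*} [Fintype ι] [DecidableEq ι] {q ν : ℂ} {R K : Matrix (ι × ι) (ι × ι) ℂ}
  {gbar g : Matrix ι ι ℂ}

theorem IsRankOneFactorization.exists_ne_zero (h : IsRankOneFactorization K gbar g)
    (hK : K ≠ 0) : (∃ i j, gbar i j ≠ 0) ∧ ∃ k l, g k l ≠ 0 := by
  constructor
  · by_contra! h0
    exact hK (Matrix.ext fun x a => by rw [h x.1 x.2 a.1 a.2, h0, zero_mul, Matrix.zero_apply])
  · by_contra! h0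
    exact hK (Matrix.ext fun x a => by rw [h x.1 x.2 a.1 a.2, h0, mul_zero, Matrix.zero_apply])

theorem IsRankOneFactorization.isUnit_Xmat (h : IsRankOneFactorization K gbar g) (hK : K ≠ 0)
    (hrel : leg (n := 3) 0 1 K * leg (n := 3) 1 2 K * leg (n := 3) 0 1 K = leg (n := 3) 0 1 K) :
    IsUnit (Xmat gbar g) := by
  obtain ⟨⟨i, j, hij⟩, k, l, hkl⟩ := h.exists_ne_zero hK
  have h1 : Xmat gbar g * (gbar * g) = 1 := by
    ext m n
    -- At these entries both sides of `K₁ K₂ K₁ = K₁` carry the nonzero factor `gbar i j * g k l`,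
    -- leaving `X (gbar g) = 1`.
    have h2 := congrFun (congrFun hrel ![i, j, m]) ![k, l, n]
    simp only [Matrix.mul_apply, sum_fin_three, leg_zero_one_apply, leg_one_two_apply, ite_mul,
      mul_ite, zero_mul, mul_zero, Finset.sum_ite_irrel, Finset.sum_const_zero,
      Finset.sum_ite_eq, Finset.sum_ite_eq', Finset.mem_univ, if_true, h i j, h _ _ _ _] at h2
    apply mul_left_cancel₀ (mul_ne_zero hij hkl)
    simp only [Xmat, Matrix.mul_apply, Matrix.one_apply, mul_ite, mul_one, mul_zero]
    rw [← h2]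
    simp only [Finset.mul_sum, Finset.sum_mul]
    refine Finset.sum_congr rfl fun x _ => Finset.sum_congr rfl fun y _ =>
      Finset.sum_congr rfl fun z _ => ?_
    ring
  exact IsUnit.of_mul_eq_one _ h1

theorem scal_mul (S : Type*) [Semiring S] [Algebra ℂ S] {κ : Type*} [Fintype κ]
    (A B : Matrix κ κ ℂ) : scal S (A * B) = scal S A * scal S B := by
  simp [scal, Matrix.map_mul]

theorem commute_scal_Kmat {S : Type*} [Ring S] [Algebra ℂ S] {M : Matrix ι ι S}
    (h : IsRTT R M) (q ν : ℂ) :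
    scal S (Kmat q ν R) * prod₁₂ M = prod₁₂ M * scal S (Kmat q ν R) := by
  let φ : Matrix (ι × ι) (ι × ι) ℂ →ₐ[ℂ] Matrix (ι × ι) (ι × ι) S :=
    (Algebra.ofId ℂ S).mapMatrix
  have hφ : ∀ A, scal S A = φ A := fun A => rfl
  have h' : Commute (φ R) (prod₁₂ M) := h
  rw [hφ, Kmat]
  simp only [map_smul, map_mul, map_sub, map_add, map_one]
  refine Commute.smul_left (Commute.mul_left (Commute.sub_left ?_ h') (Commute.add_left ?_ h')) _
  · exact (Commute.one_left _).smul_left _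
  · exact (Commute.one_left _).smul_left _

theorem scal_smul_injective {S : Type*} [Semiring S] [Algebra ℂ S] (hK : K ≠ 0) {τ τ' : S}
    (h : τ • scal S K = τ' • scal S K) : τ = τ' := by
  obtain ⟨x, a, hxa⟩ : ∃ x a, K x a ≠ 0 := by
    by_contra! h0
    exact hK (Matrix.ext h0)
  have h1 := congrFun (congrFun h x) a
  simp only [Matrix.smul_apply, scal, Matrix.map_apply, smul_eq_mul] at h1
  exact ((IsUnit.mk0 _ hxa).map (algebraMap ℂ S)).mul_left_injective h1

/-- `K T₁ T₂ = τ K` amounts to `g T₁ T₂ = τ g`. -/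
theorem isTau_iff (hf : IsRankOneFactorization K gbar g) (hK : K ≠ 0) (τ : FRT R) :
    IsTau R K τ ↔ ∀ k l, ∑ a, ∑ b, g a b • (FRT.T R a k * FRT.T R b l) = g k l • τ := by
  have h1 : ∀ i j k l, (scal (FRT R) K * prod₁₂ (FRT.T R)) (i, j) (k, l) =
      gbar i j • ∑ a, ∑ b, g a b • (FRT.T R a k * FRT.T R b l) := by
    intro i j k l
    simp only [Matrix.mul_apply, Fintype.sum_prod_type, prod₁₂_apply, scal, Matrix.map_apply,
      hf i j, ← Algebra.smul_def, Finset.smul_sum, smul_smul]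
  have h2 : ∀ i j k l, (τ • scal (FRT R) K) (i, j) (k, l) = gbar i j • g k l • τ := by
    intro i j k l
    simp only [Matrix.smul_apply, scal, Matrix.map_apply, hf i j, smul_eq_mul, smul_smul]
    rw [← Algebra.commutes, ← Algebra.smul_def]
  constructor
  · intro h k l
    obtain ⟨⟨i, j, hij⟩, -⟩ := hf.exists_ne_zero hK
    have h3 := congrFun (congrFun h (i, j)) (k, l)
    rw [h1, h2] at h3
    exact smul_right_injective _ hij h3
  · intro h
    ext ⟨i, j⟩ ⟨k, l⟩
    rw [h1, h2, h]

/-- `K T₁ T₂ = τ K` amounts to `T₁ T₂ gbar = τ gbar`. -/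
theorem isTau_iff' (hf : IsRankOneFactorization K gbar g) (hK : K ≠ 0)
    (hc : scal (FRT R) K * prod₁₂ (FRT.T R) = prod₁₂ (FRT.T R) * scal (FRT R) K) (τ : FRT R) :
    IsTau R K τ ↔ ∀ i j, ∑ a, ∑ b, gbar a b • (FRT.T R i a * FRT.T R j b) = gbar i j • τ := by
  have h1 : ∀ i j k l, (prod₁₂ (FRT.T R) * scal (FRT R) K) (i, j) (k, l) =
      g k l • ∑ a, ∑ b, gbar a b • (FRT.T R i a * FRT.T R j b) := by
    intro i j k l
    simp only [Matrix.mul_apply, Fintype.sum_prod_type, prod₁₂_apply, scal, Matrix.map_apply,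
      hf _ _ k l, ← Algebra.commutes, ← Algebra.smul_def, Finset.smul_sum, smul_smul,
      mul_comm (g k l)]
  have h2 : ∀ i j k l, (τ • scal (FRT R) K) (i, j) (k, l) = g k l • gbar i j • τ := by
    intro i j k l
    simp only [Matrix.smul_apply, scal, Matrix.map_apply, hf i j, smul_eq_mul, smul_smul]
    rw [← Algebra.commutes, ← Algebra.smul_def, mul_comm]
  unfold IsTau
  rw [hc]
  constructor
  · intro h i j
    obtain ⟨-, k, l, hkl⟩ := hf.exists_ne_zero hK
    have h3 := congrFun (congrFun h (i, j)) (k, l)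
    rw [h1, h2] at h3
    exact smul_right_injective _ hkl h3
  · intro h
    ext ⟨i, j⟩ ⟨k, l⟩
    rw [h1, h2, h]

/-- Commutation reads `gbar_{ij} (g T₁ T₂)^{kl} = (T₁ T₂ gbar)_{ij} g^{kl}`; dividing by a nonzero
`gbar i j` separates the variables, and the common ratio is `τ`. -/
theorem exists_isTau (hf : IsRankOneFactorization K gbar g) (hK : K ≠ 0)
    (hc : scal (FRT R) K * prod₁₂ (FRT.T R) = prod₁₂ (FRT.T R) * scal (FRT R) K) :
    ∃ τ, IsTau R K τ := by
  obtain ⟨⟨i, j, hij⟩, -⟩ := hf.exists_ne_zero hK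
  refine ⟨(gbar i j)⁻¹ • ∑ a, ∑ b, gbar a b • (FRT.T R i a * FRT.T R j b), ?_⟩
  rw [isTau_iff hf hK]
  intro k l
  have h1 := congrFun (congrFun hc (i, j)) (k, l)
  simp only [Matrix.mul_apply, Fintype.sum_prod_type, prod₁₂_apply, scal, Matrix.map_apply,
    hf _ _ _ _, ← Algebra.commutes, ← Algebra.smul_def] at h1
  rw [smul_comm, ← smul_right_injective _ hij |>.eq_iff]
  simp only [smul_smul (gbar i j) (gbar i j)⁻¹, mul_inv_cancel₀ hij, one_smul]
  simp only [Finset.smul_sum, smul_smul, h1, mul_comm (g k l)]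

theorem comulAlgHom_map_T :
    (FRT.T R).map (Bialgebra.comulAlgHom ℂ (FRT R)) =
      (FRT.T R).map (Algebra.TensorProduct.includeLeft : FRT R →ₐ[ℂ] FRT R ⊗[ℂ] FRT R) *
      (FRT.T R).map (Algebra.TensorProduct.includeRight : FRT R →ₐ[ℂ] FRT R ⊗[ℂ] FRT R) := by
  ext i j
  simp [FRT.comul_T, Matrix.mul_apply]

theorem IsTau.map {S : Type*} [Semiring S] [Algebra ℂ S] {τ : FRT R} (h : IsTau R K τ)
    (f : FRT R →ₐ[ℂ] S) : scal S K * prod₁₂ ((FRT.T R).map f) = f τ • scal S K := by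
  have h' := congrArg (fun A => A.map f) h
  have h2 : (τ • scal (FRT R) K).map f = f τ • scal S K := by
    ext i j
    simp [scal]
  rw [← h2, ← h', Matrix.map_mul, scal_map, prod₁₂_map]

theorem IsTau.comul_eq {τ : FRT R} (h : IsTau R K τ) (hK : K ≠ 0) :
    Coalgebra.comul (R := ℂ) τ = τ ⊗ₜ[ℂ] τ := by
  apply scal_smul_injective hK
  have h1 := h.map (Bialgebra.comulAlgHom ℂ (FRT R))
  -- The two tensor factors commute, so `T₁ T₂` is multiplicative on `Δ T` and `K` passes through
  -- one factor at a time, yielding `τ ⊗ 1` and then `1 ⊗ τ`.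
  rw [comulAlgHom_map_T, prod₁₂_mul _ _ (by intros; simp), ← mul_assoc, h.map,
    Matrix.smul_mul, h.map, smul_smul] at h1
  simpa using h1.symm

theorem IsTau.counit_eq {τ : FRT R} (h : IsTau R K τ) (hK : K ≠ 0) :
    Coalgebra.counit (R := ℂ) τ = 1 := by
  apply scal_smul_injective hK
  have h1 := h.map (Bialgebra.counitAlgHom ℂ (FRT R))
  have h2 : (FRT.T R).map (Bialgebra.counitAlgHom ℂ (FRT R)) = 1 := by
    ext i j
    simp [FRT.counit_T, Matrix.one_apply]
  rw [h2] at h1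
  simpa [prod₁₂] using h1.symm

theorem IsTau.mul_T (hf : IsRankOneFactorization K gbar g) (hK : K ≠ 0)
    (hc : scal (FRT R) K * prod₁₂ (FRT.T R) = prod₁₂ (FRT.T R) * scal (FRT R) K)
    (hX : IsUnit (Xmat gbar g)) {τ : FRT R} (h : IsTau R K τ) (i j : ι) :
    τ * FRT.T R i j = FRT.conjT R (Xmat gbar g) i j * τ := by
  have hg := (isTau_iff hf hK τ).1 h
  have hgbar := (isTau_iff' hf hK hc τ).1 h
  set X := Xmat gbar g with hXdef
  -- This is `τ T X = X T τ`: in the cubic expression below, `h1` contracts the last two `T`'s with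
  -- `gbar`, and `h2` the first two with `g`.
  have key : ∀ i j, ∑ c, X c j • (τ * FRT.T R i c) = ∑ c, X i c • (FRT.T R c j * τ) := by
    intro i k
    have h1 : ∑ a, ∑ b, ∑ c, ∑ d, (g a b * gbar c d) •
        (FRT.T R a k * (FRT.T R b c * FRT.T R i d)) = ∑ c, X i c • (FRT.T R c k * τ) := by
      calc _ = ∑ a, ∑ b, g a b • (FRT.T R a k *
            ∑ c, ∑ d, gbar c d • (FRT.T R b c * FRT.T R i d)) := by
            simp only [Finset.mul_sum, Finset.smul_sum, mul_smul, mul_smul_comm]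
        _ = _ := by simp only [hgbar, hXdef, Xmat, Finset.sum_smul, mul_smul, mul_smul_comm]
    have h2 : ∑ a, ∑ b, ∑ c, ∑ d, (g a b * gbar c d) •
        (FRT.T R a k * (FRT.T R b c * FRT.T R i d)) = ∑ c, X c k • (τ * FRT.T R i c) := by
      rw [sum_comm_two_two]
      calc _ = ∑ c, ∑ d, gbar c d • ((∑ a, ∑ b, g a b • (FRT.T R a k * FRT.T R b c)) *
            FRT.T R i d) := by
            simp only [Finset.sum_mul, Finset.smul_sum, mul_comm (g _ _), mul_smul,
              smul_mul_assoc, mul_assoc]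
        _ = _ := by
            rw [Finset.sum_comm]
            simp only [hg, hXdef, Xmat, Finset.sum_smul, mul_comm (g _ _), mul_smul,
              smul_mul_assoc]
    rw [← h1, ← h2]
  have key' : τ • (FRT.T R * scal (FRT R) X) =
      (scal (FRT R) X * FRT.T R).map (fun x => x * τ) := by
    ext i j
    simp only [Matrix.smul_apply, Matrix.map_apply, Matrix.mul_apply, scal, smul_eq_mul,
      Finset.mul_sum, Finset.sum_mul, ← Algebra.commutes, ← Algebra.smul_def, mul_smul_comm,
      smul_mul_assoc]
    exact key i j
  have hXX : scal (FRT R) X * scal (FRT R) X⁻¹ = 1 := by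
    rw [← scal_mul, Matrix.mul_nonsing_inv _ ((Matrix.isUnit_iff_isUnit_det _).1 hX)]
    simp [scal]
  -- The entries of `X⁻¹` are scalars, so they move past the `τ` standing on the right.
  have h3 : ∀ M : Matrix ι ι (FRT R), M.map (fun x => x * τ) * scal (FRT R) X⁻¹ =
      (M * scal (FRT R) X⁻¹).map (fun x => x * τ) := by
    intro M
    ext i j
    simp only [Matrix.mul_apply, Matrix.map_apply, scal, Finset.sum_mul, mul_assoc,
      Algebra.commutes]
  have h4 := congrArg (fun M => M * scal (FRT R) X⁻¹) key'
  simp only [Matrix.smul_mul, mul_assoc (FRT.T R), hXX, mul_one, h3] at h4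
  exact congrFun (congrFun h4 i) j

end Tau

end FRTBMW

theorem proposition3 {V ι : Type*} [AddCommGroup V] [Module ℂ V] [Fintype ι] [DecidableEq ι]
    (b : Module.Basis ι ℂ V) (Rhat : (V ⊗[ℂ] V) ≃ₗ[ℂ] (V ⊗[ℂ] V))
    (R : Matrix (ι × ι) (ι × ι) ℂ) (hR : R = FRTBMW.tensorMatrix b Rhat.toLinearMap)
    (q ν : ℂ) (hskew : FRTBMW.IsSkewInvertible R) (hBMW : FRTBMW.IsBMWType q ν R) :
    (∃ gbar g : Matrix ι ι ℂ, FRTBMW.IsRankOneFactorization (FRTBMW.Kmat q ν R) gbar g) ∧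
    ∀ gbar g : Matrix ι ι ℂ, FRTBMW.IsRankOneFactorization (FRTBMW.Kmat q ν R) gbar g →
      IsUnit (FRTBMW.Xmat gbar g) ∧
      (∃! τ : FRTBMW.FRT R, FRTBMW.IsTau R (FRTBMW.Kmat q ν R) τ) ∧
      ∀ τ : FRTBMW.FRT R, FRTBMW.IsTau R (FRTBMW.Kmat q ν R) τ →
        Coalgebra.comul (R := ℂ) τ = τ ⊗ₜ[ℂ] τ ∧
        Coalgebra.counit (R := ℂ) τ = 1 ∧
        ∀ i j : ι, τ * FRTBMW.FRT.T R i j = FRTBMW.FRT.conjT R (FRTBMW.Xmat gbar g) i j * τ := by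
  have hK := hBMW.Kmat_ne_zero
  obtain ⟨hrel, hrot⟩ := hBMW.Kmat_relations
  have hc := FRTBMW.commute_scal_Kmat (FRTBMW.FRT.isRTT_T R) q ν
  refine ⟨?_, fun gbar g hf => ?_⟩
  · obtain ⟨C, hC⟩ := FRTBMW.exists_factorization_of_skew hskew hrot
    -- Over an empty index set `K` would be zero.
    have : Nonempty ι := by
      by_contra h0
      rw [not_nonempty_iff] at h0
      exact hK (Subsingleton.elim _ _)
    exact FRTBMW.exists_isRankOneFactorization fun x y a b =>
      FRTBMW.minor_eq_zero_of_factorization hC x y a b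
  · have hX := hf.isUnit_Xmat hK hrel
    obtain ⟨τ, hτ⟩ := FRTBMW.exists_isTau hf hK hc
    refine ⟨hX, ⟨τ, hτ, fun τ' hτ' => ?_⟩, fun τ hτ => ⟨hτ.comul_eq hK, hτ.counit_eq hK,
      hτ.mul_T hf hK hc hX⟩⟩
    exact FRTBMW.scal_smul_injective hK (hτ'.symm.trans hτ)
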